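/- Let $T$ be a densely defined maximal dissipative operator in a complex Hilbert space $H$: $\operatorname{Im}(Tf,f)\ge 0$ for all $f\in\operatorname{dom}T$, and $T$ has no proper dissipative extension in $H$. Assume that $T$ belongs to the class $\mathbf D_{\rm sing}$, i.e. that the form $\gamma_T[f]=\operatorname{Im}(Tf,f)$ on $\operatorname{dom}T$ is singular: for every $\varphi\in\operatorname{dom}T$ there are $\varphi_n\in\operatorname{dom}T$ with $\varphi_n\to 0$ in $H$ and $\gamma_T[\varphi-\varphi_n]\to 0$. Assume that $\operatorname{dom}T\cap\operatorname{dom}T^*$ is different from $\{0\}$ and is not dense in $H$. Let $\{E,\Gamma\}$ be any boundary pair for $T$, i.e. $E$ is a complex Hilbert space and $\Gamma:\operatorname{dom}T\to E$ is a linear operator with dense range such that $(Tf,g)-(f,Tg)=2i(\Gamma f,\Gamma g)_E$ for all $f,g\in\operatorname{dom}T$. For $z$ with $\operatorname{Im}z>0$ let $\mathcal T_z$ be the operator in $H\oplus E$ with $$\operatorname{dom}\mathcal T_z=\Big\{\Big(f,-\tfrac{\Gamma f}{\sqrt{\operatorname{Im}z}}\Big): f\in\operatorname{dom}T\Big\},\qquad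 \mathcal T_z\Big(f,-\tfrac{\Gamma f}{\sqrt{\operatorname{Im}z}}\Big)=\Big(Tf,-\tfrac{\bar z\,\Gamma f}{\sqrt{\operatorname{Im}z}}\Big)$$ (this is the Hermitian part of the lifting $\widetilde{\mathcal T}_z(f,e)=(Tf,\,2i\sqrt{\operatorname{Im}z}\,\Gamma f+ze)$, $\operatorname{dom}\widetilde{\mathcal T}_z=\operatorname{dom}T\oplus E$, that is, its restriction to the vectors $u$ with $\operatorname{Im}(\widetilde{\mathcal T}_zu,u)=0$). Let $\operatorname{dom}\mathcal T_z^2=\{x\in\operatorname{dom}\mathcal T_z:\mathcal T_zx\in\operatorname{dom}\mathcal T_z\}$, and let $$\mathcal L_T=\operatorname{ran}\big(\operatorname{Im}(T^*-iI)^{-1}\big)^{1/2},\qquad \operatorname{Im}B=\tfrac1{2i}(B-B^*).$$ Then for every $z$ with $\operatorname{Im}z>0$: 1. $\operatorname{dom}\mathcal T_z^2$ is dense in $H\oplus E$ if and only if $\mathcal L_T\cap(\operatorname{dom}T\cap\operatorname{dom}T^*)^\perp=\{0\}$; 2. $\operatorname{dom}\mathcal T_z^2$ is not dense in $H\oplus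 E$ if and only if $\mathcal L_T\cap(\operatorname{dom}T\cap\operatorname{dom}T^*)^\perp\ne\{0\}$. -/

import Mathlib

open Filter Topology

noncomputable section

namespace DissipativeLifting

variable {H E : Type*}
  [NormedAddCommGroup H] [InnerProductSpace ℂ H]
  [NormedAddCommGroup E] [InnerProductSpace ℂ E]

/-- The form `γ_T[f] = Im (T f, f)` on `dom T`. Mathlib's inner product is linear in the second
argument, so `(T f, f)` is written `inner ℂ f (T f)`. -/
def imForm (T : H →ₗ.[ℂ] H) (f : T.domain) : ℝ :=
  (inner ℂ (f : H) (T f)).im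

/-- `T` is dissipative: `Im (T f, f) ≥ 0` for all `f ∈ dom T`. -/
def IsDissipative (T : H →ₗ.[ℂ] H) : Prop :=
  ∀ f : T.domain, 0 ≤ imForm T f

/-- A densely defined dissipative operator without proper dissipative extensions in `H`. -/
structure IsMaximalDissipative (T : H →ₗ.[ℂ] H) : Prop where
  dense_domain : Dense (T.domain : Set H)
  dissipative : IsDissipative T
  maximal : ∀ T' : H →ₗ.[ℂ] H, IsDissipative T' → T ≤ T' → T' = T

/-- A form `a` on a linear manifold `D` is singular if for every `φ ∈ D` there is a sequence in `D`
converging to `0` in `H` with `a[φ - φ_n] → 0`. -/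
def IsSingularForm {D : Submodule ℂ H} (a : D → ℝ) : Prop :=
  ∀ φ : D, ∃ u : ℕ → D,
    Tendsto (fun n => (u n : H)) atTop (𝓝 0) ∧ Tendsto (fun n => a (φ - u n)) atTop (𝓝 0)

/-- The class of maximal dissipative operators whose form `Im (T f, f)` is singular. -/
structure MemDSing (T : H →ₗ.[ℂ] H) : Prop where
  maximalDissipative : IsMaximalDissipative T
  singular : IsSingularForm (imForm T)

/-- `(E, Γ)` is a boundary pair for `T`: the operator `Γ : dom T → E` has dense range and satisfies
the Green identity `(T f, g) - (f, T g) = 2 i (Γ f, Γ g)`. -/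
structure IsBoundaryPair (T : H →ₗ.[ℂ] H) (Γ : T.domain →ₗ[ℂ] E) : Prop where
  denseRange : DenseRange Γ
  green : ∀ f g : T.domain,
    inner ℂ (g : H) (T f) - inner ℂ (T g) (f : H) = 2 * Complex.I * inner ℂ (Γ g) (Γ f)

/-- The Hermitian domain `{f ∈ dom T : Im (T f, f) = 0}`. -/
def hermitianDomain (T : H →ₗ.[ℂ] H) : Set H :=
  {f | ∃ hf : f ∈ T.domain, imForm T ⟨f, hf⟩ = 0}

/-- The bounded operator `R` is the inverse of `A - μ`, as a map from `dom A` to `H`. -/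
structure IsResolvent (A : H →ₗ.[ℂ] H) (μ : ℂ) (R : H →L[ℂ] H) : Prop where
  mem_domain : ∀ x, R x ∈ A.domain
  right_inv : ∀ x, A ⟨R x, mem_domain x⟩ - μ • R x = x
  left_inv : ∀ x : A.domain, R (A x - μ • (x : H)) = x

theorem IsResolvent.unique {A : H →ₗ.[ℂ] H} {μ : ℂ} {R R' : H →L[ℂ] H}
    (h : IsResolvent A μ R) (h' : IsResolvent A μ R') : R = R' := by
  ext x
  have := h'.left_inv ⟨R x, h.mem_domain x⟩
  rw [h.right_inv x] at this
  exact this.symm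

open Classical in
/-- The resolvent `(A - μ)⁻¹` (with the value `0` if `μ` is not in the resolvent set of `A`). -/
def resolvent (A : H →ₗ.[ℂ] H) (μ : ℂ) : H →L[ℂ] H :=
  if h : ∃ R : H →L[ℂ] H, IsResolvent A μ R then h.choose else 0

theorem IsResolvent.resolvent_eq {A : H →ₗ.[ℂ] H} {μ : ℂ} {R : H →L[ℂ] H}
    (h : IsResolvent A μ R) : resolvent A μ = R := by
  have hex : ∃ R : H →L[ℂ] H, IsResolvent A μ R := ⟨R, h⟩
  rw [resolvent, dif_pos hex]
  exact hex.choose_spec.unique h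

/-- The linear manifold `L_T = ran (Im (T* - i)⁻¹)^(1/2)`, where `Im B = (B - B*) / (2 i)` and the
square root is that of a nonnegative bounded operator. -/
def manifoldL [CompleteSpace H] (T : H →ₗ.[ℂ] H) : Submodule ℂ H :=
  LinearMap.range
    (CFC.sqrt (imaginaryPart (resolvent T.adjoint Complex.I) : H →L[ℂ] H)).toLinearMap

/-- The domain `{x ∈ dom A : A x ∈ dom A}` of the square of `A`. -/
def sqDomain (A : H →ₗ.[ℂ] H) : Submodule ℂ H :=
  (A.domain.comap A.toFun).map A.domain.subtype

theorem mem_sqDomain {A : H →ₗ.[ℂ] H} {x : H} :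
    x ∈ sqDomain A ↔ ∃ hx : x ∈ A.domain, A ⟨x, hx⟩ ∈ A.domain := by
  constructor
  · rintro ⟨y, hy, rfl⟩
    exact ⟨y.2, hy⟩
  · rintro ⟨hx, h⟩
    exact ⟨⟨x, hx⟩, h, rfl⟩

/-- The map `dom T → H ⊕ E`, `f ↦ (f, -Γ f / √(Im z))`. -/
def embed (T : H →ₗ.[ℂ] H) (Γ : T.domain →ₗ[ℂ] E) (z : ℂ) : T.domain →ₗ[ℂ] WithLp 2 (H × E) :=
  (WithLp.linearEquiv 2 ℂ (H × E)).symm.toLinearMap ∘ₗ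
    LinearMap.prod T.domain.subtype (-((Real.sqrt z.im : ℂ)⁻¹) • Γ)

theorem fst_mem_domain {T : H →ₗ.[ℂ] H} {Γ : T.domain →ₗ[ℂ] E} {z : ℂ} {x : WithLp 2 (H × E)}
    (hx : x ∈ LinearMap.range (embed T Γ z)) : x.fst ∈ T.domain := by
  obtain ⟨f, rfl⟩ := hx
  exact f.2

/-- The symmetric operator `𝒯_z` in `H ⊕ E` with domain `{(f, -Γ f / √(Im z)) : f ∈ dom T}` and
`𝒯_z (f, -Γ f / √(Im z)) = (T f, -z̄ Γ f / √(Im z))`. -/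
def symmOp (T : H →ₗ.[ℂ] H) (Γ : T.domain →ₗ[ℂ] E) (z : ℂ) :
    WithLp 2 (H × E) →ₗ.[ℂ] WithLp 2 (H × E) where
  domain := LinearMap.range (embed T Γ z)
  toFun :=
    { toFun := fun x => WithLp.toLp 2
        (T ⟨x.1.fst, fst_mem_domain x.2⟩,
          (-(starRingEnd ℂ z * (Real.sqrt z.im : ℂ)⁻¹)) • Γ ⟨x.1.fst, fst_mem_domain x.2⟩)
      map_add' := fun x y => by
        rw [← WithLp.toLp_add, Prod.mk_add_mk, ← smul_add, ← map_add, ← LinearPMap.map_add]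
        rfl
      map_smul' := fun c x => by
        rw [RingHom.id_apply, ← WithLp.toLp_smul, Prod.smul_mk, smul_comm c, ← Γ.map_smul c,
          ← LinearPMap.map_smul]
        rfl }

theorem embed_mem (T : H →ₗ.[ℂ] H) (Γ : T.domain →ₗ[ℂ] E) (z : ℂ) (f : T.domain) :
    WithLp.toLp 2 ((f : H), (-(Real.sqrt z.im : ℂ)⁻¹) • Γ f) ∈ (symmOp T Γ z).domain :=
  ⟨f, rfl⟩

theorem symmOp_apply (T : H →ₗ.[ℂ] H) (Γ : T.domain →ₗ[ℂ] E) (z : ℂ) (f : T.domain) :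
    symmOp T Γ z ⟨_, embed_mem T Γ z f⟩ =
      WithLp.toLp 2 (T f, (-(starRingEnd ℂ z * (Real.sqrt z.im : ℂ)⁻¹)) • Γ f) :=
  rfl

/-- The lifting of `T` to `H ⊕ E`, with domain `dom T ⊕ E`, given by
`(f, e) ↦ (T f, 2 i √(Im z) Γ f + z e)`. -/
def lifting (T : H →ₗ.[ℂ] H) (Γ : T.domain →ₗ[ℂ] E) (z : ℂ) :
    WithLp 2 (H × E) →ₗ.[ℂ] WithLp 2 (H × E) where
  domain := T.domain.comap
    (LinearMap.fst ℂ H E ∘ₗ (WithLp.linearEquiv 2 ℂ (H × E)).toLinearMap)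
  toFun :=
    { toFun := fun x => WithLp.toLp 2
        (T ⟨x.1.fst, x.2⟩,
          (2 * Complex.I * (Real.sqrt z.im : ℂ)) • Γ ⟨x.1.fst, x.2⟩ + z • x.1.snd)
      map_add' := fun x y => by
        rw [← WithLp.toLp_add, Prod.mk_add_mk, add_add_add_comm, ← smul_add, ← smul_add,
          ← map_add, ← LinearPMap.map_add]
        rfl
      map_smul' := fun c x => by
        rw [RingHom.id_apply, ← WithLp.toLp_smul, Prod.smul_mk, smul_add, smul_comm c,
          smul_comm c z, ← Γ.map_smul c, ← LinearPMap.map_smul]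
        rfl }

/-- `𝒯_z` is a restriction of the lifting of `T`. -/
theorem symmOp_le_lifting (T : H →ₗ.[ℂ] H) (Γ : T.domain →ₗ[ℂ] E) {z : ℂ} (hz : 0 < z.im) :
    symmOp T Γ z ≤ lifting T Γ z := by
  have hs : (Real.sqrt z.im : ℂ) ≠ 0 := by exact_mod_cast (Real.sqrt_pos.2 hz).ne'
  have hsq : (Real.sqrt z.im : ℂ) * (Real.sqrt z.im : ℂ) = (z.im : ℂ) := by
    exact_mod_cast Real.mul_self_sqrt hz.le
  refine ⟨fun x hx => fst_mem_domain hx, ?_⟩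
  rintro ⟨_, f, rfl⟩ ⟨_, hy⟩ rfl
  refine congrArg (WithLp.toLp 2) (Prod.ext rfl ?_)
  change (-(starRingEnd ℂ z * (Real.sqrt z.im : ℂ)⁻¹)) • Γ f =
    (2 * Complex.I * (Real.sqrt z.im : ℂ)) • Γ f + z • ((-(Real.sqrt z.im : ℂ)⁻¹) • Γ f)
  rw [smul_smul, ← add_smul]
  congr 1
  have hc : starRingEnd ℂ z = z - 2 * Complex.I * z.im := by
    apply Complex.ext <;> simp
    ring
  rw [hc, ← hsq]
  field_simp
  ring

theorem imForm_lifting {T : H →ₗ.[ℂ] H} {Γ : T.domain →ₗ[ℂ] E} (hΓ : IsBoundaryPair T Γ)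
    {z : ℂ} (hz : 0 < z.im) (x : (lifting T Γ z).domain) :
    imForm (lifting T Γ z) x =
      ‖Γ ⟨x.1.fst, x.2⟩ + (Real.sqrt z.im : ℂ) • x.1.snd‖ ^ 2 := by
  have hg : (inner ℂ (x.1.fst) (T ⟨x.1.fst, x.2⟩) : ℂ).im = ‖Γ ⟨x.1.fst, x.2⟩‖ ^ 2 := by
    have h := congrArg Complex.im (hΓ.green ⟨x.1.fst, x.2⟩ ⟨x.1.fst, x.2⟩)
    rw [← inner_conj_symm (T ⟨x.1.fst, x.2⟩) x.1.fst, inner_self_eq_norm_sq_to_K] at h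
    norm_cast at h
    simp at h
    norm_cast at h
    have hi : (inner ℂ (T ⟨x.1.fst, x.2⟩) (x.1.fst) : ℂ).im =
        -(inner ℂ (x.1.fst) (T ⟨x.1.fst, x.2⟩) : ℂ).im := inner_im_symm (𝕜 := ℂ) _ _
    linarith
  have hl : imForm (lifting T Γ z) x = (inner ℂ (x.1.fst) (T ⟨x.1.fst, x.2⟩) +
      inner ℂ (x.1.snd) ((2 * Complex.I * (Real.sqrt z.im : ℂ)) • Γ ⟨x.1.fst, x.2⟩ +
        z • x.1.snd) : ℂ).im := rfl
  have hn := norm_add_sq (𝕜 := ℂ) (Γ ⟨x.1.fst, x.2⟩) ((Real.sqrt z.im : ℂ) • x.1.snd)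
  rw [inner_smul_right, norm_smul, ← inner_conj_symm, mul_pow] at hn
  have hsq : ‖(Real.sqrt z.im : ℂ)‖ ^ 2 = z.im := by
    rw [Complex.norm_real, Real.norm_eq_abs, sq_abs, Real.sq_sqrt hz.le]
  rw [hn, hsq, hl, Complex.add_im, hg, inner_add_right, inner_smul_right, inner_smul_right,
    inner_self_eq_norm_sq_to_K]
  have hc : (((‖x.1.snd‖ : ℝ) : ℂ) ^ 2).im = 0 := by norm_cast
  have hr : (((‖x.1.snd‖ : ℝ) : ℂ) ^ 2).re = ‖x.1.snd‖ ^ 2 := by norm_cast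
  have hre : (inner ℂ (Γ ⟨x.1.fst, x.2⟩) (x.1.snd) : ℂ).re =
      (inner ℂ (x.1.snd) (Γ ⟨x.1.fst, x.2⟩) : ℂ).re := inner_re_symm (𝕜 := ℂ) _ _
  simp [hc, hr, hre]
  ring

/-- The domain of `𝒯_z` is the Hermitian domain of the lifting of `T`; hence `𝒯_z` is the Hermitian
part of the lifting. -/
theorem symmOp_domain_eq {T : H →ₗ.[ℂ] H} {Γ : T.domain →ₗ[ℂ] E} (hΓ : IsBoundaryPair T Γ)
    {z : ℂ} (hz : 0 < z.im) :
    ((symmOp T Γ z).domain : Set (WithLp 2 (H × E))) = hermitianDomain (lifting T Γ z) := by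
  have hs : (Real.sqrt z.im : ℂ) ≠ 0 := by exact_mod_cast (Real.sqrt_pos.2 hz).ne'
  ext x
  constructor
  · rintro ⟨f, rfl⟩
    refine ⟨f.2, ?_⟩
    rw [imForm_lifting hΓ hz]
    change ‖Γ f + (Real.sqrt z.im : ℂ) • ((-(Real.sqrt z.im : ℂ)⁻¹) • Γ f)‖ ^ 2 = 0
    rw [smul_smul, mul_neg, mul_inv_cancel₀ hs]
    simp
  · rintro ⟨hx, h⟩
    rw [imForm_lifting hΓ hz] at h
    have h0 := norm_eq_zero.1 (pow_eq_zero_iff two_ne_zero |>.1 h)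
    refine ⟨⟨x.fst, hx⟩, ?_⟩
    refine congrArg (WithLp.toLp 2) (Prod.ext rfl ?_)
    change (-(Real.sqrt z.im : ℂ)⁻¹) • Γ ⟨x.fst, hx⟩ = x.snd
    rw [eq_neg_of_add_eq_zero_left h0, smul_neg, neg_smul, neg_neg, smul_smul,
      inv_mul_cancel₀ hs, one_smul]

end DissipativeLifting

end

/-!
Put `R = (T - z̄)⁻¹`, which is an everywhere defined bounded operator because `T` is maximal
dissipative (`IsMaximalDissipative.exists_isResolvent`), and lift it to the bounded operator
`V g = (R g, -Γ R g / √(Im z))` from `H` to `H ⊕ E` (`graphResolvent`). Its range is `dom 𝒯_z`.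

Singularity of the form enters twice. It makes the graph of `Γ`, hence `dom 𝒯_z`, dense in `H ⊕ E`
(`IsBoundaryPair.denseRange_embed`), so that `V*` is injective. It also gives
`ker Γ = dom T ∩ dom T*` (`IsBoundaryPair.mem_adjoint_domain_iff`). The vector
`(f, -Γ f / √(Im z))` is in the domain of `𝒯_z²` iff `Γ (T - z̄) f = 0`, and so that domain is
the image of `D = dom T ∩ dom T*` under `V` (`IsBoundaryPair.sqDomain_symmOp_eq`). A vector `x` is
orthogonal to it iff `V* x` is orthogonal to `D`; since `V*` is injective, `dom 𝒯_z²` is dense iff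
`ran V* ∩ Dᗮ = {0}` (`dense_map_iff`).

It remains to identify `ran V*` with `L_T`. The Green identity gives
`Im z * ‖V g‖² = Im ⟪R g, g⟫`. For `z = i` the right-hand side is the quadratic form of
`Im (T* - i)⁻¹`, so `V` and the square root of `Im (T* - i)⁻¹` have the same norm at each vector,
and by Douglas' lemma (`range_adjoint_le_of_norm_le`) their adjoints have the same range
(`manifoldL_eq_range_adjoint`). By the resolvent identity the norms `‖V g‖` for two values of `z`
are equivalent, so `ran V*` does not depend on `z` (`range_adjoint_graphResolvent_eq`).
-/

namespace DissipativeLifting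

variable {H E : Type*}
  [NormedAddCommGroup H] [InnerProductSpace ℂ H]
  [NormedAddCommGroup E] [InnerProductSpace ℂ E]

/-! ### Resolvents of maximal dissipative operators -/

theorem im_inner_self_sub_smul {T : H →ₗ.[ℂ] H} (μ : ℂ) (f : T.domain) :
    (inner ℂ (f : H) (T f - μ • (f : H))).im = imForm T f - μ.im * ‖(f : H)‖ ^ 2 := by
  rw [inner_sub_right, inner_smul_right, inner_self_eq_norm_sq_to_K, imForm]
  simp [← Complex.ofReal_pow]

/-- A maximal dissipative operator contains every vector `(f, k)` that can be added to its graph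
without losing dissipativity. -/
theorem IsMaximalDissipative.exists_apply_eq {T : H →ₗ.[ℂ] H} (hT : IsMaximalDissipative T)
    {f k : H} (h : ∀ (u : T.domain) (c : ℂ), 0 ≤ (inner ℂ ((u : H) + c • f) (T u + c • k)).im) :
    ∃ hf : f ∈ T.domain, T ⟨f, hf⟩ = k := by
  have hf : f ∈ T.domain := by
    by_contra hf
    have hext : T.supSpanSingleton f k hf = T := by
      refine hT.maximal _ ?_ (LinearPMap.left_le_sup _ _ _)
      rintro ⟨x, hx⟩
      obtain ⟨u, hu, v, hv, rfl⟩ := Submodule.mem_sup.1 hx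
      obtain ⟨c, rfl⟩ := Submodule.mem_span_singleton.1 hv
      have := h ⟨u, hu⟩ c
      rw [imForm, LinearPMap.supSpanSingleton_apply_mk _ _ _ _ _ hu]
      exact this
    apply hf
    rw [← hext]
    exact Submodule.mem_sup_right (Submodule.mem_span_singleton_self _)
  refine ⟨hf, ?_⟩
  suffices hw : k - T ⟨f, hf⟩ = 0 from (sub_eq_zero.1 hw).symm
  refine hT.dense_domain.eq_zero_of_inner_right ℂ fun u hu => ?_
  by_contra ha
  set a : ℂ := inner ℂ u (k - T ⟨f, hf⟩) with ha_def
  -- `h` applied to `u - c f` is affine in `c`, with slope `a`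
  have key : ∀ c : ℂ, 0 ≤ imForm T ⟨u, hu⟩ + (c * a).im := by
    intro c
    have := h (⟨u, hu⟩ - c • ⟨f, hf⟩) c
    rw [LinearPMap.map_sub, LinearPMap.map_smul] at this
    have e1 : ((⟨u, hu⟩ - c • ⟨f, hf⟩ : T.domain) : H) + c • f = u := by simp
    have e2 : T ⟨u, hu⟩ - c • T ⟨f, hf⟩ + c • k = T ⟨u, hu⟩ + c • (k - T ⟨f, hf⟩) := by
      rw [smul_sub]; abel
    rw [e1, e2, inner_add_right, inner_smul_right, Complex.add_im] at this
    exact this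
  have hpos : 0 < Complex.normSq a := Complex.normSq_pos.2 ha
  have := key (-Complex.I * starRingEnd ℂ a *
    (((imForm T ⟨u, hu⟩ + 1) / Complex.normSq a : ℝ) : ℂ))
  have e : -Complex.I * starRingEnd ℂ a *
      (((imForm T ⟨u, hu⟩ + 1) / Complex.normSq a : ℝ) : ℂ) * a =
      -Complex.I * ((imForm T ⟨u, hu⟩ + 1 : ℝ) : ℂ) := by
    have : starRingEnd ℂ a * a = (Complex.normSq a : ℂ) := by
      rw [mul_comm, Complex.mul_conj]
    have h0 : (Complex.normSq a : ℂ) ≠ 0 := by exact_mod_cast hpos.ne'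
    calc _ = -Complex.I * (((imForm T ⟨u, hu⟩ + 1) / Complex.normSq a : ℝ) : ℂ) *
        (starRingEnd ℂ a * a) := by ring
      _ = _ := by
        rw [this]
        push_cast
        field_simp
  rw [e] at this
  simp at this
  linarith

/-- A dissipative operator minus a point of the lower half-plane is bounded below. -/
theorem IsDissipative.le_norm_sub_smul {T : H →ₗ.[ℂ] H} (hT : IsDissipative T) (z : ℂ)
    (f : T.domain) : z.im * ‖(f : H)‖ ≤ ‖T f - starRingEnd ℂ z • (f : H)‖ := by
  have h1 := im_inner_self_sub_smul (starRingEnd ℂ z) f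
  have h2 := (Complex.im_le_norm _).trans
    (norm_inner_le_norm (𝕜 := ℂ) (f : H) (T f - starRingEnd ℂ z • (f : H)))
  have h3 := hT f
  rw [Complex.conj_im] at h1
  rcases (norm_nonneg (f : H)).eq_or_lt with h0 | h0
  · rw [← h0, mul_zero]; exact norm_nonneg _
  · nlinarith

/-- `T - z̄` maps `dom T` onto `H`: its range is closed because `T` contains the limits of its
graph, and dense because a vector orthogonal to the range could be added to `dom T`. -/
theorem IsMaximalDissipative.exists_sub_smul_eq [CompleteSpace H] {T : H →ₗ.[ℂ] H}
    (hT : IsMaximalDissipative T) {z : ℂ} (hz : 0 < z.im) (g : H) :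
    ∃ f : T.domain, T f - starRingEnd ℂ z • (f : H) = g := by
  let A : T.domain →ₗ[ℂ] H := T.toFun - starRingEnd ℂ z • T.domain.subtype
  have hA : ∀ f : T.domain, A f = T f - starRingEnd ℂ z • (f : H) := fun f => rfl
  have hlow : ∀ f : T.domain, z.im * ‖(f : H)‖ ≤ ‖A f‖ :=
    hT.dissipative.le_norm_sub_smul z
  have hclosed : IsClosed (LinearMap.range A : Set H) := by
    rw [← isSeqClosed_iff_isClosed]
    intro v g hv hg
    choose u hu using hv
    have hcau : CauchySeq fun n => (u n : H) := by
      rw [Metric.cauchySeq_iff]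
      intro ε hε
      obtain ⟨N, hN⟩ := Metric.cauchySeq_iff.1 hg.cauchySeq (z.im * ε) (mul_pos hz hε)
      refine ⟨N, fun m hm n hn => ?_⟩
      have h1 := hlow (u m - u n)
      have h2 := hN m hm n hn
      rw [dist_eq_norm, ← hu, ← hu, ← map_sub] at h2
      rw [dist_eq_norm]
      exact lt_of_mul_lt_mul_left (h1.trans_lt h2) hz.le
    obtain ⟨f, hf⟩ := cauchySeq_tendsto_of_complete hcau
    have hTu : Tendsto (fun n => T (u n)) atTop (𝓝 (g + starRingEnd ℂ z • f)) := by
      refine (hg.add (hf.const_smul (starRingEnd ℂ z))).congr fun n => ?_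
      rw [← hu, hA, sub_add_cancel]
    obtain ⟨hfd, hTf⟩ := hT.exists_apply_eq (f := f) (k := g + starRingEnd ℂ z • f) fun x c => by
      have hlim : Tendsto (fun n => (inner ℂ ((x : H) + c • (u n : H)) (T x + c • T (u n))).im)
          atTop (𝓝 (inner ℂ ((x : H) + c • f) (T x + c • (g + starRingEnd ℂ z • f))).im) :=
        (Complex.continuous_im.tendsto _).comp
          ((tendsto_const_nhds.add (hf.const_smul c)).inner
            (tendsto_const_nhds.add (hTu.const_smul c)))
      refine ge_of_tendsto' hlim fun n => ?_
      have := hT.dissipative (x + c • u n)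
      rwa [imForm, LinearPMap.map_add, LinearPMap.map_smul] at this
    refine ⟨⟨f, hfd⟩, ?_⟩
    rw [hA, hTf, add_sub_cancel_right]
  -- the range is closed, so it remains to see that nothing is orthogonal to it
  suffices htop : LinearMap.range A = ⊤ by
    obtain ⟨f, hf⟩ := LinearMap.range_eq_top.1 htop g
    exact ⟨f, hf⟩
  have : CompleteSpace (LinearMap.range A) := hclosed.completeSpace_coe
  rw [← Submodule.orthogonal_eq_bot_iff, Submodule.eq_bot_iff]
  intro h hh
  have horth : ∀ u : T.domain, inner ℂ h (T u - starRingEnd ℂ z • (u : H)) = 0 := fun u =>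
    (Submodule.mem_orthogonal' _ _).1 hh _ ⟨u, rfl⟩
  -- a vector orthogonal to the range can be added to the domain as an eigenvector for `z`
  obtain ⟨hd, hTh⟩ := hT.exists_apply_eq (f := h) (k := z • h) fun u c => by
    have h1 := horth u
    -- for `v = u + c • h` and `T' v = T u + c • z • h`,
    -- `Im (T' v, v) = Im (T u, u) + Im z * ‖c • h‖ ^ 2`
    have hzz : z = starRingEnd ℂ z + 2 * Complex.I * z.im := by
      apply Complex.ext <;> simp
      ring
    have hTu : T u + c • z • h = (T u - starRingEnd ℂ z • (u : H)) +
        starRingEnd ℂ z • ((u : H) + c • h) + (2 * Complex.I * z.im * c) • h := by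
      conv_lhs => rw [hzz]
      module
    have h3 := im_inner_self_sub_smul (starRingEnd ℂ z) u
    have h4 := hT.dissipative u
    have hn : ‖(u : H) + c • h‖ ^ 2 =
        ‖(u : H)‖ ^ 2 + 2 * (c * inner ℂ (u : H) h).re + ‖c‖ ^ 2 * ‖h‖ ^ 2 := by
      rw [norm_add_sq (𝕜 := ℂ), inner_smul_right, norm_smul, mul_pow]
      rfl
    have e1 : inner ℂ ((u : H) + c • h) (T u - starRingEnd ℂ z • (u : H)) =
        inner ℂ (u : H) (T u - starRingEnd ℂ z • (u : H)) := by
      rw [inner_add_left, inner_smul_left, h1, mul_zero, add_zero]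
    have e2 : inner ℂ ((u : H) + c • h) h * c =
        c * inner ℂ (u : H) h + ((‖c‖ ^ 2 * ‖h‖ ^ 2 : ℝ) : ℂ) := by
      rw [inner_add_left, inner_smul_left, inner_self_eq_norm_sq_to_K, add_mul]
      have := Complex.conj_mul' c
      push_cast
      rw [← this]
      simp
      ring
    have e3 : ((2 * Complex.I * z.im * c) * inner ℂ ((u : H) + c • h) h).im =
        2 * z.im * ((c * inner ℂ (u : H) h).re + ‖c‖ ^ 2 * ‖h‖ ^ 2) := by
      have : (2 * Complex.I * z.im * c) * inner ℂ ((u : H) + c • h) h =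
          ((2 * z.im : ℝ) : ℂ) * (Complex.I * (inner ℂ ((u : H) + c • h) h * c)) := by
        push_cast; ring
      rw [this, e2, Complex.im_ofReal_mul, Complex.I_mul_im, Complex.add_re, Complex.ofReal_re]
    rw [hTu, inner_add_right, inner_add_right, e1, inner_smul_right, inner_smul_right,
      inner_self_eq_norm_sq_to_K, Complex.add_im, Complex.add_im, e3, h3]
    have e4 : (starRingEnd ℂ z * ((‖(u : H) + c • h‖ : ℝ) : ℂ) ^ 2).im =
        -z.im * ‖(u : H) + c • h‖ ^ 2 := by
      rw [← Complex.ofReal_pow, Complex.im_mul_ofReal, Complex.conj_im]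
    have e5 := e4
    rw [hn] at e5
    refine le_of_le_of_eq ?_ (congrArg₂ _ (congrArg₂ _ rfl e5.symm) rfl)
    rw [Complex.conj_im]
    have h5 : 0 ≤ z.im * (‖c‖ ^ 2 * ‖h‖ ^ 2) := by positivity
    nlinarith
  have h1 := horth ⟨h, hd⟩
  rw [hTh, ← sub_smul, inner_smul_right] at h1
  rcases mul_eq_zero.1 h1 with h2 | h2
  · have := congrArg Complex.im h2
    simp at this
    exact absurd this hz.ne'
  · exact inner_self_eq_zero.1 h2

/-- The lower half-plane is in the resolvent set of a maximal dissipative operator. -/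
theorem IsMaximalDissipative.exists_isResolvent [CompleteSpace H] {T : H →ₗ.[ℂ] H}
    (hT : IsMaximalDissipative T) {z : ℂ} (hz : 0 < z.im) :
    ∃ R : H →L[ℂ] H, IsResolvent T (starRingEnd ℂ z) R := by
  let A : T.domain →ₗ[ℂ] H := T.toFun - starRingEnd ℂ z • T.domain.subtype
  have hlow : ∀ f : T.domain, z.im * ‖(f : H)‖ ≤ ‖A f‖ :=
    hT.dissipative.le_norm_sub_smul z
  have hinj : Function.Injective A := by
    rw [injective_iff_map_eq_zero]
    intro f hf
    have := hlow f
    rw [hf, norm_zero] at this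
    have h0 : ‖(f : H)‖ ≤ 0 := by
      by_contra hc
      exact absurd this (not_le.2 (mul_pos hz (not_le.1 hc)))
    exact Subtype.ext (norm_le_zero_iff.1 h0)
  let e := LinearEquiv.ofBijective A ⟨hinj, hT.exists_sub_smul_eq hz⟩
  let R : H →L[ℂ] H := (T.domain.subtype ∘ₗ e.symm.toLinearMap).mkContinuous z.im⁻¹ fun x => by
    have := hlow (e.symm x)
    rw [show A (e.symm x) = x from e.apply_symm_apply x] at this
    rw [inv_mul_eq_div, le_div_iff₀ hz, mul_comm]
    exact this
  refine ⟨R, fun x => (e.symm x).2, fun x => e.apply_symm_apply x, fun x => ?_⟩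
  exact congrArg Subtype.val (e.symm_apply_apply x)

/-- Two resolvents are related by `R' - R = (μ' - μ) R' R`. -/
theorem IsResolvent.apply_eq_add {T : H →ₗ.[ℂ] H} {μ μ' : ℂ} {R R' : H →L[ℂ] H}
    (h : IsResolvent T μ R) (h' : IsResolvent T μ' R') (g : H) :
    R' g = R g + (μ' - μ) • R' (R g) := by
  have h1 := h'.left_inv ⟨R g, h.mem_domain g⟩
  have h2 := h.right_inv g
  have h3 : T ⟨R g, h.mem_domain g⟩ - μ' • R g = g - (μ' - μ) • R g := by
    have h4 : T ⟨R g, h.mem_domain g⟩ = g + μ • R g := sub_eq_iff_eq_add.1 h2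
    rw [h4]
    module
  rw [h3, map_sub, map_smul] at h1
  exact sub_eq_iff_eq_add.1 h1

open ContinuousLinearMap in
/-- The adjoint of a resolvent is a resolvent of the adjoint operator. -/
theorem IsResolvent.adjoint [CompleteSpace H] {T : H →ₗ.[ℂ] H} (hd : Dense (T.domain : Set H))
    {μ : ℂ} {R : H →L[ℂ] H} (h : IsResolvent T μ R) :
    IsResolvent T.adjoint (starRingEnd ℂ μ) (ContinuousLinearMap.adjoint R) := by
  have key : ∀ (x : H) (u : T.domain),
      inner ℂ (x + starRingEnd ℂ μ • ContinuousLinearMap.adjoint R x) (u : H) =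
        inner ℂ (ContinuousLinearMap.adjoint R x) (T u) := by
    intro x u
    have h1 := h.left_inv u
    rw [map_sub, map_smul, sub_eq_iff_eq_add] at h1
    rw [adjoint_inner_left, h1, inner_add_left, inner_add_right, inner_smul_left,
      inner_smul_right, adjoint_inner_left, Complex.conj_conj]
  have hmem : ∀ x, ContinuousLinearMap.adjoint R x ∈ T.adjoint.domain := fun x =>
    LinearPMap.mem_adjoint_domain_of_exists _ ⟨_, key x⟩
  refine ⟨hmem, fun x => ?_, fun y => ?_⟩
  · rw [LinearPMap.adjoint_apply_eq hd ⟨_, hmem x⟩ (key x), add_sub_cancel_right]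
  · refine ext_inner_right ℂ fun u => ?_
    have h1 := LinearPMap.adjoint_isFormalAdjoint hd y ⟨R u, h.mem_domain u⟩
    rw [adjoint_inner_left, inner_sub_left, inner_smul_left, Complex.conj_conj, h1,
      ← inner_smul_right, ← inner_sub_right, h.right_inv]

/-! ### Ranges of adjoints -/

/-- Douglas' range inclusion: a norm inequality between operators gives the inclusion of the
ranges of their adjoints. -/
theorem range_adjoint_le_of_norm_le {X Y Z : Type*}
    [NormedAddCommGroup X] [InnerProductSpace ℂ X] [CompleteSpace X]
    [NormedAddCommGroup Y] [InnerProductSpace ℂ Y] [CompleteSpace Y]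
    [NormedAddCommGroup Z] [InnerProductSpace ℂ Z] [CompleteSpace Z]
    (A : X →L[ℂ] Y) (B : X →L[ℂ] Z) (C : ℝ) (h : ∀ x, ‖A x‖ ≤ C * ‖B x‖) :
    LinearMap.range (ContinuousLinearMap.adjoint A).toLinearMap ≤
      LinearMap.range (ContinuousLinearMap.adjoint B).toLinearMap := by
  rintro _ ⟨y, rfl⟩
  -- `B x ↦ ⟪y, A x⟫` is a bounded functional on the range of `B`
  have hker : LinearMap.ker B.toLinearMap ≤ LinearMap.ker A.toLinearMap := fun x hx => by
    have h0 := h x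
    rw [show B x = 0 from hx, norm_zero, mul_zero] at h0
    exact norm_le_zero_iff.1 h0
  let φ : LinearMap.range B.toLinearMap →ₗ[ℂ] ℂ :=
    (innerSL ℂ y).toLinearMap ∘ₗ (LinearMap.ker B.toLinearMap).liftQ A.toLinearMap hker ∘ₗ
      B.toLinearMap.quotKerEquivRange.symm.toLinearMap
  have hφ : ∀ x, φ ⟨B x, x, rfl⟩ = inner ℂ y (A x) := fun x => by
    have : B.toLinearMap.quotKerEquivRange.symm ⟨B x, x, rfl⟩ = Submodule.Quotient.mk x := by
      rw [LinearEquiv.symm_apply_eq]; rfl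
    change inner ℂ y ((LinearMap.ker B.toLinearMap).liftQ A.toLinearMap hker
      (B.toLinearMap.quotKerEquivRange.symm ⟨B x, x, rfl⟩)) = _
    rw [this]; rfl
  let ψ : StrongDual ℂ (LinearMap.range B.toLinearMap) := φ.mkContinuous (‖y‖ * C) <| by
    rintro ⟨_, x, rfl⟩
    calc ‖φ ⟨B x, x, rfl⟩‖ = ‖inner ℂ y (A x)‖ := by rw [hφ]
      _ ≤ ‖y‖ * ‖A x‖ := norm_inner_le_norm _ _
      _ ≤ ‖y‖ * (C * ‖B x‖) := by gcongr; exact h x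
      _ = ‖y‖ * C * ‖B x‖ := by ring
  obtain ⟨χ, hχ, -⟩ := exists_extension_norm_eq (𝕜 := ℂ) (LinearMap.range B.toLinearMap) ψ
  refine ⟨(InnerProductSpace.toDual ℂ Z).symm χ, ?_⟩
  refine ext_inner_right ℂ fun x => ?_
  change inner ℂ (ContinuousLinearMap.adjoint B _) x = inner ℂ (ContinuousLinearMap.adjoint A y) x
  rw [ContinuousLinearMap.adjoint_inner_left, ContinuousLinearMap.adjoint_inner_left,
    InnerProductSpace.toDual_symm_apply]
  exact (hχ ⟨B x, x, rfl⟩).trans (hφ x)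

open ContinuousLinearMap in
theorem norm_sqrt_apply_sq [CompleteSpace H] {B : H →L[ℂ] H} (hB : 0 ≤ B) (x : H) :
    ‖CFC.sqrt B x‖ ^ 2 = (inner ℂ x (B x)).re := by
  have hsa : ContinuousLinearMap.adjoint (CFC.sqrt B) = CFC.sqrt B :=
    (CFC.sqrt_nonneg B).isSelfAdjoint
  have h : B x = CFC.sqrt B (CFC.sqrt B x) :=
    (congrArg (fun S : H →L[ℂ] H => S x) (CFC.sqrt_mul_sqrt_self B hB)).symm
  rw [h, ← adjoint_inner_left, hsa, inner_self_eq_norm_sq_to_K]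
  simp [← Complex.ofReal_pow]

/-- The image of `D` under an operator with dense range is dense iff only the zero vector of the
range of the adjoint is orthogonal to `D`. -/
theorem dense_map_iff {X Y : Type*}
    [NormedAddCommGroup X] [InnerProductSpace ℂ X] [CompleteSpace X]
    [NormedAddCommGroup Y] [InnerProductSpace ℂ Y] [CompleteSpace Y]
    (V : X →L[ℂ] Y) (hV : DenseRange V) (D : Submodule ℂ X) :
    Dense (D.map V.toLinearMap : Set Y) ↔
      LinearMap.range (ContinuousLinearMap.adjoint V).toLinearMap ⊓ Dᗮ = ⊥ := by
  have hinj : ∀ y, ContinuousLinearMap.adjoint V y = 0 → y = 0 := fun y hy => by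
    refine hV.eq_zero_of_inner_left ℂ ?_
    intro x
    rw [← ContinuousLinearMap.adjoint_inner_left, hy, inner_zero_left]
  have hmem : ∀ y, y ∈ (D.map V.toLinearMap)ᗮ ↔ ContinuousLinearMap.adjoint V y ∈ Dᗮ := fun y => by
    simp [Submodule.mem_orthogonal', ContinuousLinearMap.adjoint_inner_left]
  rw [Submodule.dense_iff_topologicalClosure_eq_top, Submodule.topologicalClosure_eq_top_iff,
    Submodule.eq_bot_iff, Submodule.eq_bot_iff]
  constructor
  · rintro h _ ⟨⟨y, rfl⟩, hy⟩
    rw [h y ((hmem y).2 hy), map_zero]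
  · intro h y hy
    exact hinj y (h _ ⟨⟨y, rfl⟩, (hmem y).1 hy⟩)

/-! ### Boundary pairs -/

section BoundaryPair

variable {T : H →ₗ.[ℂ] H} {Γ : T.domain →ₗ[ℂ] E}

theorem IsBoundaryPair.imForm_eq (hΓ : IsBoundaryPair T Γ) (f : T.domain) :
    imForm T f = ‖Γ f‖ ^ 2 := by
  have h := congrArg Complex.im (hΓ.green f f)
  have hi : (inner ℂ (T f) (f : H) : ℂ).im = -(inner ℂ (f : H) (T f) : ℂ).im :=
    inner_im_symm (𝕜 := ℂ) _ _
  rw [inner_self_eq_norm_sq_to_K, Complex.sub_im, hi] at h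
  rw [imForm]
  simp [← Complex.ofReal_pow, mul_assoc] at h
  linarith

/-- Singularity of the form says that every `(0, Γ f)` is a limit of points of the graph of `Γ`. -/
theorem IsBoundaryPair.exists_seq (hΓ : IsBoundaryPair T Γ) (hs : IsSingularForm (imForm T))
    (f : T.domain) : ∃ u : ℕ → T.domain, Tendsto (fun n => (u n : H)) atTop (𝓝 0) ∧
      Tendsto (fun n => Γ (u n)) atTop (𝓝 (Γ f)) := by
  obtain ⟨u, hu, hu'⟩ := hs f
  refine ⟨u, hu, ?_⟩
  simp only [hΓ.imForm_eq] at hu'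
  have h1 : Tendsto (fun n => ‖Γ (f - u n)‖) atTop (𝓝 0) := by
    simpa [Real.sqrt_sq] using hu'.sqrt
  have h2 := tendsto_zero_iff_norm_tendsto_zero.2 h1
  have h3 := (tendsto_const_nhds (x := Γ f)).sub h2
  simpa using h3

/-- For a singular form the domain of the Hermitian part is `dom T ∩ dom T*`. -/
theorem IsBoundaryPair.mem_adjoint_domain_iff [CompleteSpace H] (hΓ : IsBoundaryPair T Γ)
    (hd : Dense (T.domain : Set H)) (hs : IsSingularForm (imForm T)) (f : T.domain) :
    (f : H) ∈ T.adjoint.domain ↔ Γ f = 0 := by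
  constructor
  · intro hf
    refine hΓ.denseRange.eq_zero_of_inner_right ℂ ?_
    intro g
    obtain ⟨u, hu, hu'⟩ := hΓ.exists_seq hs g
    -- `⟪Γ u, Γ f⟫` depends continuously on `u` in the norm of `H`
    have hgreen : ∀ v : T.domain, inner ℂ (Γ v) (Γ f) =
        (2 * Complex.I)⁻¹ * inner ℂ (v : H) (T f - T.adjoint ⟨f, hf⟩) := fun v => by
      have h1 := hΓ.green f v
      have h2 := (LinearPMap.adjoint_isFormalAdjoint hd).symm v ⟨f, hf⟩
      rw [inner_sub_right, ← h2, h1, inv_mul_cancel_left₀ (by simp)]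
    have h1 : Tendsto (fun n => inner ℂ (Γ (u n)) (Γ f)) atTop (𝓝 0) := by
      simp only [hgreen]
      have := (hu.inner (tendsto_const_nhds (x := T f - T.adjoint ⟨f, hf⟩))
        (𝕜 := ℂ)).const_mul ((2 * Complex.I)⁻¹)
      rwa [inner_zero_left, mul_zero] at this
    exact tendsto_nhds_unique (hu'.inner tendsto_const_nhds) h1
  · intro hf
    refine LinearPMap.mem_adjoint_domain_of_exists _ ⟨T f, fun g => ?_⟩
    have h := hΓ.green g f
    rw [hf, inner_zero_left, mul_zero, sub_eq_zero] at h
    exact h.symm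

theorem norm_embed_sq {z : ℂ} (hz : 0 < z.im) (f : T.domain) :
    ‖embed T Γ z f‖ ^ 2 = ‖(f : H)‖ ^ 2 + z.im⁻¹ * ‖Γ f‖ ^ 2 := by
  rw [WithLp.prod_norm_sq_eq_of_L2]
  change ‖(f : H)‖ ^ 2 + ‖(-((Real.sqrt z.im : ℂ)⁻¹)) • Γ f‖ ^ 2 = _
  rw [norm_smul, norm_neg, norm_inv, Complex.norm_real, Real.norm_eq_abs, mul_pow, inv_pow, sq_abs,
    Real.sq_sqrt hz.le]

theorem norm_le_norm_embed {z : ℂ} (hz : 0 < z.im) (f : T.domain) :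
    ‖(f : H)‖ ≤ ‖embed T Γ z f‖ := by
  refine le_of_sq_le_sq ?_ (norm_nonneg _)
  rw [norm_embed_sq hz]
  have : 0 ≤ z.im⁻¹ * ‖Γ f‖ ^ 2 := by positivity
  linarith

theorem IsBoundaryPair.norm_embed_sq (hΓ : IsBoundaryPair T Γ) {z : ℂ} (hz : 0 < z.im)
    (f : T.domain) : z.im * ‖embed T Γ z f‖ ^ 2 =
      (inner ℂ (f : H) (T f - starRingEnd ℂ z • (f : H))).im := by
  rw [im_inner_self_sub_smul, hΓ.imForm_eq, DissipativeLifting.norm_embed_sq hz, Complex.conj_im,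
    mul_add, mul_inv_cancel_left₀ hz.ne']
  ring

/-- The graph norms of the operators `-Γ / √(Im z)` are equivalent. -/
theorem norm_embed_le {z w : ℂ} (hz : 0 < z.im) (hw : 0 < w.im) (f : T.domain) :
    ‖embed T Γ z f‖ ≤ (1 + w.im / z.im) * ‖embed T Γ w f‖ := by
  have hr : 0 < w.im / z.im := div_pos hw hz
  refine le_of_sq_le_sq ?_ (by positivity)
  rw [mul_pow, norm_embed_sq hz, norm_embed_sq hw]
  have e : z.im⁻¹ * ‖Γ f‖ ^ 2 = (w.im / z.im) * (w.im⁻¹ * ‖Γ f‖ ^ 2) := by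
    field_simp
  have h1 : 0 ≤ w.im⁻¹ * ‖Γ f‖ ^ 2 := by positivity
  have h2 : 0 ≤ ‖(f : H)‖ ^ 2 := by positivity
  rw [e]
  nlinarith [mul_nonneg hr.le h2, mul_nonneg hr.le h1, mul_nonneg (sq_nonneg (w.im / z.im)) h2,
    mul_nonneg (sq_nonneg (w.im / z.im)) h1]

/-- Singularity of the form makes the graph of `-Γ / √(Im z)` dense in `H ⊕ E`. -/
theorem IsBoundaryPair.denseRange_embed [CompleteSpace H] [CompleteSpace E]
    (hΓ : IsBoundaryPair T Γ) (hd : Dense (T.domain : Set H)) (hs : IsSingularForm (imForm T))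
    {z : ℂ} (hz : 0 < z.im) : DenseRange (embed T Γ z) := by
  have hsq : (-(Real.sqrt z.im : ℂ)⁻¹) ≠ 0 := by
    have : (Real.sqrt z.im : ℂ) ≠ 0 := by exact_mod_cast (Real.sqrt_pos.2 hz).ne'
    exact neg_ne_zero.2 (inv_ne_zero this)
  rw [DenseRange, ← LinearMap.coe_range, Submodule.dense_iff_topologicalClosure_eq_top,
    Submodule.topologicalClosure_eq_top_iff, Submodule.eq_bot_iff]
  intro x hx
  have horth : ∀ f : T.domain, inner ℂ x.fst (f : H) +
      (-(Real.sqrt z.im : ℂ)⁻¹) * inner ℂ x.snd (Γ f) = 0 := fun f => by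
    have := (Submodule.mem_orthogonal' _ _).1 hx _ ⟨f, rfl⟩
    rw [← inner_smul_right]
    exact this
  have hsnd : x.snd = 0 := by
    refine hΓ.denseRange.eq_zero_of_inner_left ℂ ?_
    intro f
    obtain ⟨u, hu, hu'⟩ := hΓ.exists_seq hs f
    have h1 : Tendsto (fun n => inner ℂ x.fst (u n : H) +
        (-(Real.sqrt z.im : ℂ)⁻¹) * inner ℂ x.snd (Γ (u n))) atTop
        (𝓝 (inner ℂ x.fst (0 : H) + (-(Real.sqrt z.im : ℂ)⁻¹) * inner ℂ x.snd (Γ f))) :=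
      (tendsto_const_nhds.inner hu).add ((tendsto_const_nhds.inner hu').const_mul _)
    simp only [horth, inner_zero_right, zero_add] at h1
    exact (mul_eq_zero.1 (tendsto_nhds_unique tendsto_const_nhds h1).symm).resolve_left hsq
  have hfst : x.fst = 0 := by
    refine hd.eq_zero_of_inner_left ℂ fun f hf => ?_
    have := horth ⟨f, hf⟩
    rwa [hsnd, inner_zero_left, mul_zero, add_zero] at this
  exact (WithLp.ofLp_eq_zero 2).1 (Prod.ext hfst hsnd)

/-- The map `g ↦ (R g, -Γ R g / √(Im z))`, where `R = (T - z̄)⁻¹`; that is, the lifting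
`H → H ⊕ E` of the resolvent to the graph of `-Γ / √(Im z)`. -/
noncomputable def graphResolvent (hΓ : IsBoundaryPair T Γ) {z : ℂ} (hz : 0 < z.im) {R : H →L[ℂ] H}
    (hR : IsResolvent T (starRingEnd ℂ z) R) : H →L[ℂ] WithLp 2 (H × E) :=
  (embed T Γ z ∘ₗ R.toLinearMap.codRestrict T.domain hR.mem_domain).mkContinuous z.im⁻¹ fun g => by
    have h1 := hΓ.norm_embed_sq hz ⟨R g, hR.mem_domain g⟩
    rw [hR.right_inv] at h1
    have h2 := (Complex.im_le_norm _).trans (norm_inner_le_norm (𝕜 := ℂ) (R g) g)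
    have h3 := norm_le_norm_embed (Γ := Γ) hz ⟨R g, hR.mem_domain g⟩
    change ‖embed T Γ z ⟨R g, hR.mem_domain g⟩‖ ≤ _
    rw [inv_mul_eq_div, le_div_iff₀ hz]
    set N := ‖embed T Γ z ⟨R g, hR.mem_domain g⟩‖
    rcases (norm_nonneg _ : 0 ≤ N).eq_or_lt with h0 | h0
    · rw [show N = 0 from h0.symm, zero_mul]; exact norm_nonneg _
    · have h4 : ‖R g‖ * ‖g‖ ≤ N * ‖g‖ := mul_le_mul_of_nonneg_right h3 (norm_nonneg _)
      have h5 : N * (N * z.im) ≤ N * ‖g‖ := by nlinarith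
      exact le_of_mul_le_mul_left h5 h0

theorem graphResolvent_apply (hΓ : IsBoundaryPair T Γ) {z : ℂ} (hz : 0 < z.im) {R : H →L[ℂ] H}
    (hR : IsResolvent T (starRingEnd ℂ z) R) (g : H) :
    graphResolvent hΓ hz hR g = embed T Γ z ⟨R g, hR.mem_domain g⟩ := rfl

theorem norm_graphResolvent_sq (hΓ : IsBoundaryPair T Γ) {z : ℂ} (hz : 0 < z.im) {R : H →L[ℂ] H}
    (hR : IsResolvent T (starRingEnd ℂ z) R) (g : H) :
    z.im * ‖graphResolvent hΓ hz hR g‖ ^ 2 = (inner ℂ (R g) g).im := by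
  rw [graphResolvent_apply, hΓ.norm_embed_sq hz, hR.right_inv]

/-- The lifted resolvents at two points have equivalent norms, because
`R = S + (z̄ - w̄) R S` and the first coordinate `S g` is controlled by the whole vector. -/
theorem norm_graphResolvent_le (hΓ : IsBoundaryPair T Γ) {z w : ℂ} (hz : 0 < z.im)
    (hw : 0 < w.im) {R S : H →L[ℂ] H} (hR : IsResolvent T (starRingEnd ℂ z) R)
    (hS : IsResolvent T (starRingEnd ℂ w) S) :
    ∃ C : ℝ, ∀ g, ‖graphResolvent hΓ hz hR g‖ ≤ C * ‖graphResolvent hΓ hw hS g‖ := by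
  set c : ℂ := starRingEnd ℂ z - starRingEnd ℂ w
  refine ⟨(1 + w.im / z.im) + ‖c‖ * ‖graphResolvent hΓ hz hR‖, fun g => ?_⟩
  have h1 : graphResolvent hΓ hz hR g = embed T Γ z ⟨S g, hS.mem_domain g⟩ +
      c • graphResolvent hΓ hz hR (S g) := by
    rw [graphResolvent_apply, graphResolvent_apply, ← map_smul, ← map_add]
    exact congrArg _ (Subtype.ext (hS.apply_eq_add hR g))
  have h2 := norm_embed_le (Γ := Γ) hz hw ⟨S g, hS.mem_domain g⟩
  have h3 := norm_le_norm_embed (Γ := Γ) hw ⟨S g, hS.mem_domain g⟩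
  rw [← graphResolvent_apply hΓ hw hS] at h2 h3
  rw [h1]
  calc _ ≤ ‖embed T Γ z ⟨S g, hS.mem_domain g⟩‖ + ‖c‖ * ‖graphResolvent hΓ hz hR (S g)‖ := by
        rw [← norm_smul]; exact norm_add_le _ _
    _ ≤ (1 + w.im / z.im) * ‖graphResolvent hΓ hw hS g‖ +
        ‖c‖ * (‖graphResolvent hΓ hz hR‖ * ‖graphResolvent hΓ hw hS g‖) := by
        gcongr
        exact (ContinuousLinearMap.le_opNorm _ _).trans (by gcongr)
    _ = _ := by ring

/-- The range of the adjoint of the lifted resolvent does not depend on the point. -/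
theorem range_adjoint_graphResolvent_eq [CompleteSpace H] [CompleteSpace E]
    (hΓ : IsBoundaryPair T Γ) {z w : ℂ} (hz : 0 < z.im) (hw : 0 < w.im) {R S : H →L[ℂ] H}
    (hR : IsResolvent T (starRingEnd ℂ z) R) (hS : IsResolvent T (starRingEnd ℂ w) S) :
    LinearMap.range (ContinuousLinearMap.adjoint (graphResolvent hΓ hz hR)).toLinearMap =
      LinearMap.range (ContinuousLinearMap.adjoint (graphResolvent hΓ hw hS)).toLinearMap := by
  obtain ⟨C, hC⟩ := norm_graphResolvent_le hΓ hz hw hR hS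
  obtain ⟨C', hC'⟩ := norm_graphResolvent_le hΓ hw hz hS hR
  exact le_antisymm (range_adjoint_le_of_norm_le _ _ C hC)
    (range_adjoint_le_of_norm_le _ _ C' hC')

theorem IsBoundaryPair.denseRange_graphResolvent [CompleteSpace H] [CompleteSpace E]
    (hΓ : IsBoundaryPair T Γ) (hd : Dense (T.domain : Set H)) (hs : IsSingularForm (imForm T))
    {z : ℂ} (hz : 0 < z.im) {R : H →L[ℂ] H} (hR : IsResolvent T (starRingEnd ℂ z) R) :
    DenseRange (graphResolvent hΓ hz hR) := by
  refine (hΓ.denseRange_embed hd hs hz).mono ?_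
  rintro _ ⟨f, rfl⟩
  refine ⟨T f - starRingEnd ℂ z • (f : H), ?_⟩
  rw [graphResolvent_apply]
  exact congrArg _ (Subtype.ext (hR.left_inv f))

/-- The vector `(f, -Γ f / √(Im z))` is in the domain of `𝒯_z²` iff `Γ (T - z̄) f = 0`, that is,
iff `f` is the image under the resolvent of a vector of `dom T ∩ dom T*`. -/
theorem IsBoundaryPair.sqDomain_symmOp_eq [CompleteSpace H] (hΓ : IsBoundaryPair T Γ)
    (hd : Dense (T.domain : Set H)) (hs : IsSingularForm (imForm T)) {z : ℂ} (hz : 0 < z.im)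
    {R : H →L[ℂ] H} (hR : IsResolvent T (starRingEnd ℂ z) R) :
    sqDomain (symmOp T Γ z) =
      (T.domain ⊓ T.adjoint.domain).map (graphResolvent hΓ hz hR).toLinearMap := by
  have hsq : (-(Real.sqrt z.im : ℂ)⁻¹) ≠ 0 := by
    have : (Real.sqrt z.im : ℂ) ≠ 0 := by exact_mod_cast (Real.sqrt_pos.2 hz).ne'
    exact neg_ne_zero.2 (inv_ne_zero this)
  have hiff : ∀ f : T.domain, symmOp T Γ z ⟨_, embed_mem T Γ z f⟩ ∈ (symmOp T Γ z).domain ↔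
      T f - starRingEnd ℂ z • (f : H) ∈ T.domain ⊓ T.adjoint.domain := by
    intro f
    rw [symmOp_apply, neg_mul_eq_mul_neg, mul_comm]
    constructor
    · rintro ⟨k, hk⟩
      have h1 : (k : H) = T f := congrArg WithLp.fst hk
      have h2 : (-(Real.sqrt z.im : ℂ)⁻¹) • Γ k =
          (-(Real.sqrt z.im : ℂ)⁻¹ * starRingEnd ℂ z) • Γ f := congrArg WithLp.snd hk
      rw [mul_smul, smul_right_inj hsq, ← map_smul, ← sub_eq_zero, ← map_sub] at h2
      rw [← h1]
      exact ⟨(k - starRingEnd ℂ z • f).2, (hΓ.mem_adjoint_domain_iff hd hs _).2 h2⟩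
    · rintro ⟨h1, h2⟩
      have h3 := (hΓ.mem_adjoint_domain_iff hd hs ⟨_, h1⟩).1 h2
      refine ⟨⟨_, h1⟩ + starRingEnd ℂ z • f, congrArg (WithLp.toLp 2) (Prod.ext ?_ ?_)⟩
      · exact sub_add_cancel _ _
      · change (-(Real.sqrt z.im : ℂ)⁻¹) • Γ (⟨_, h1⟩ + starRingEnd ℂ z • f) = _
        rw [map_add, h3, zero_add, map_smul, mul_smul]
  ext x
  rw [mem_sqDomain]
  constructor
  · rintro ⟨⟨f, rfl⟩, hx⟩
    refine ⟨_, (hiff f).1 hx, ?_⟩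
    exact congrArg (embed T Γ z) (Subtype.ext (hR.left_inv f))
  · rintro ⟨g, hg, rfl⟩
    refine ⟨⟨⟨R g, hR.mem_domain g⟩, rfl⟩, (hiff ⟨R g, hR.mem_domain g⟩).2 ?_⟩
    rwa [hR.right_inv]

/-! ### The manifold `L_T` -/

open ContinuousLinearMap in
theorem inner_imaginaryPart_adjoint [CompleteSpace H] (R : H →L[ℂ] H) (g : H) :
    inner ℂ g ((imaginaryPart (ContinuousLinearMap.adjoint R) : H →L[ℂ] H) g) =
      ((inner ℂ (R g) g).im : ℂ) := by
  rw [imaginaryPart_apply_coe, star_eq_adjoint, adjoint_adjoint]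
  change inner ℂ g (-Complex.I • (2 : ℝ)⁻¹ • (ContinuousLinearMap.adjoint R g - R g)) = _
  rw [inner_smul_right, inner_smul_right_eq_smul, inner_sub_right, adjoint_inner_right,
    ← inner_conj_symm g (R g), Complex.sub_conj]
  apply Complex.ext <;> simp

/-- Both `√(Im (T* - i)⁻¹)` and the lifted resolvent at `z = i` have the quadratic form
`Im ((T* - i)⁻¹ g, g)`. -/
theorem manifoldL_eq_range_adjoint [CompleteSpace H] [CompleteSpace E]
    (hΓ : IsBoundaryPair T Γ) (hd : Dense (T.domain : Set H))
    (hi : 0 < Complex.I.im) {R : H →L[ℂ] H}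
    (hR : IsResolvent T (starRingEnd ℂ Complex.I) R) :
    manifoldL T =
      LinearMap.range (ContinuousLinearMap.adjoint (graphResolvent hΓ hi hR)).toLinearMap := by
  have hres : resolvent T.adjoint Complex.I = ContinuousLinearMap.adjoint R := by
    have := hR.adjoint hd
    rw [Complex.conj_conj] at this
    exact this.resolvent_eq
  set B : H →L[ℂ] H := (imaginaryPart (ContinuousLinearMap.adjoint R) : H →L[ℂ] H) with hB_def
  have hV : ∀ g, ‖graphResolvent hΓ hi hR g‖ ^ 2 = (inner ℂ (R g) g).im := fun g => by
    have := norm_graphResolvent_sq hΓ hi hR g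
    rwa [Complex.I_im, one_mul] at this
  have hB : 0 ≤ B := by
    rw [ContinuousLinearMap.nonneg_iff_isPositive]
    refine (ContinuousLinearMap.isPositive_iff' _).2
      ⟨(imaginaryPart (ContinuousLinearMap.adjoint R)).2, fun g => ?_⟩
    have h : inner ℂ g (B g) = ((inner ℂ (R g) g).im : ℂ) := inner_imaginaryPart_adjoint R g
    rw [← inner_conj_symm, h, ← hV, Complex.conj_ofReal]
    exact_mod_cast sq_nonneg ‖graphResolvent hΓ hi hR g‖
  have hnorm : ∀ g, ‖CFC.sqrt B g‖ = ‖graphResolvent hΓ hi hR g‖ := fun g => by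
    rw [← sq_eq_sq₀ (norm_nonneg _) (norm_nonneg _), norm_sqrt_apply_sq hB, hV,
      inner_imaginaryPart_adjoint, Complex.ofReal_re]
  have hsa : ContinuousLinearMap.adjoint (CFC.sqrt B) = CFC.sqrt B :=
    (CFC.sqrt_nonneg B).isSelfAdjoint
  rw [manifoldL, hres, ← hB_def, ← hsa]
  refine le_antisymm (range_adjoint_le_of_norm_le _ _ 1 fun g => ?_)
    (range_adjoint_le_of_norm_le _ _ 1 fun g => ?_)
  · rw [one_mul, hnorm]
  · rw [one_mul, hnorm]

end BoundaryPair

end DissipativeLifting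

theorem theorem7p6 {H E : Type*}
    [NormedAddCommGroup H] [InnerProductSpace ℂ H] [CompleteSpace H]
    [NormedAddCommGroup E] [InnerProductSpace ℂ E] [CompleteSpace E]
    (T : H →ₗ.[ℂ] H) (hT : DissipativeLifting.MemDSing T)
    (hne : T.domain ⊓ T.adjoint.domain ≠ ⊥)
    (hnd : ¬ Dense ((T.domain ⊓ T.adjoint.domain : Submodule ℂ H) : Set H))
    (Γ : T.domain →ₗ[ℂ] E) (hΓ : DissipativeLifting.IsBoundaryPair T Γ)
    (z : ℂ) (hz : 0 < z.im) :
    (Dense (DissipativeLifting.sqDomain (DissipativeLifting.symmOp T Γ z) :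
          Set (WithLp 2 (H × E))) ↔
        DissipativeLifting.manifoldL T ⊓ (T.domain ⊓ T.adjoint.domain)ᗮ = ⊥) ∧
      (¬ Dense (DissipativeLifting.sqDomain (DissipativeLifting.symmOp T Γ z) :
          Set (WithLp 2 (H × E))) ↔
        DissipativeLifting.manifoldL T ⊓ (T.domain ⊓ T.adjoint.domain)ᗮ ≠ ⊥) := by
  have hd := hT.maximalDissipative.dense_domain
  have hi : 0 < Complex.I.im := by simp
  obtain ⟨R, hR⟩ := hT.maximalDissipative.exists_isResolvent hz
  obtain ⟨S, hS⟩ := hT.maximalDissipative.exists_isResolvent hi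
  have key : Dense (DissipativeLifting.sqDomain (DissipativeLifting.symmOp T Γ z) :
      Set (WithLp 2 (H × E))) ↔
        DissipativeLifting.manifoldL T ⊓ (T.domain ⊓ T.adjoint.domain)ᗮ = ⊥ := by
    rw [hΓ.sqDomain_symmOp_eq hd hT.singular hz hR,
      DissipativeLifting.dense_map_iff _ (hΓ.denseRange_graphResolvent hd hT.singular hz hR),
      DissipativeLifting.manifoldL_eq_range_adjoint hΓ hd hi hS,
      DissipativeLifting.range_adjoint_graphResolvent_eq hΓ hz hi hR hS]
  exact ⟨key, not_congr key⟩
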